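/- Let $\mathbb{D}=\{z\in\mathbb{C}:|z|<1\}$ and let $\mathcal{F}_4$ be the class of functions $f$ analytic in $\mathbb{D}$, normalized by $f(z)=z+a_2z^2+a_3z^3+\cdots$, such that $\operatorname{Re}\big((1-z)^2f'(z)\big)>0$ for all $z\in\mathbb{D}$. Every $f\in\mathcal{F}_4$ is injective on $\mathbb{D}$, and its inverse function $f^{-1}:f(\mathbb{D})\to\mathbb{D}$ is analytic near $0$; write $f^{-1}(w)=w+\sum_{n\ge 2}\delta_nw^n$ near $0$. Then, for every $f\in\mathcal{F}_4$, $$|\delta_2|\le 2,\qquad |\delta_3|\le 5,$$ and if moreover $a_2\in\mathbb{R}$, then $$|\delta_4|\le 14,\qquad |\delta_5|\le 42.$$ All four bounds are sharp: there is a function $f\in\mathcal{F}_4$ satisfying $$zf'(z)=\frac{z}{(1-z)^2}\cdot\frac{1+z}{1-z}\qquad(z\in\mathbb{D}),$$ whose coefficient $a_2$ is real and for which $|\delta_2|=2$, $|\delta_3|=5$, $|\delta_4|=14$ and $|\delta_5|=42$. -/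

import Mathlib

/-- The open unit disk in the complex plane. -/
def unitDisk : Set ℂ := Metric.ball 0 1

/-- Normalized analytic functions on the unit disk: `f (z) = z + a₂ z² + a₃ z³ + ⋯`.
Only the values of `f` on the disk matter. -/
def ClassA : Set (ℂ → ℂ) :=
  {f | AnalyticOnNhd ℂ f unitDisk ∧ f 0 = 0 ∧ deriv f 0 = 1}

/-- The class of normalized analytic `f` with `Re ((1 - z)² f' (z)) > 0` on the unit disk. -/
def ClassF4 : Set (ℂ → ℂ) :=
  {f | f ∈ ClassA ∧ ∀ z ∈ unitDisk, 0 < ((1 - z) ^ 2 * deriv f z).re}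

/-- The `n`-th Taylor coefficient at the origin. -/
noncomputable def taylorCoeff (f : ℂ → ℂ) (n : ℕ) : ℂ :=
  iteratedDeriv n f 0 / (n.factorial : ℂ)

/-- The inverse function of `f` restricted to the unit disk; for `f` injective on the disk it is
the map sending `f z` to `z` for each `z` in the disk. -/
noncomputable def diskInverse (f : ℂ → ℂ) : ℂ → ℂ :=
  Function.invFunOn f unitDisk

/-- The inverse coefficients: `f⁻¹ (w) = w + δ₂ w² + δ₃ w³ + ⋯` near the origin. -/
noncomputable def inverseCoeff (f : ℂ → ℂ) (n : ℕ) : ℂ :=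
  taylorCoeff (diskInverse f) n

/-! Put q = 1 / ((1 - z)² f'). It has positive real part and q(0) = 1, so Carathéodory gives |qₙ| ≤
2 for n ≥ 1 (`norm_taylorCoeff_le_of_re_nonneg`). Since φ = 1 / f' = (1 - z)² q, the coefficients bₙ
of φ are second differences of the qₙ, whence |b₁| ≤ 4, |b₂| ≤ 7, |b₃|, |b₄| ≤ 8. The inverse g
satisfies g' = φ ∘ g, so its derivatives at 0 come from iterating φ · d/dz on the identity. By
`inverseCoeff_eq` each δₙ is a polynomial in the bₖ with positive coefficients, and the triangle
inequality gives 2, 5, 14, 42. For the Koebe function q = (1 - z) / (1 + z), and every inequality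
used is an equality. -/

/-! ### Carathéodory's inequality -/

open Metric in
/-- If `q` is analytic in the unit disk with nonnegative real part and Taylor coefficients `qₙ`,
then `Re (2 q₀ + c rⁿ qₙ)` is nonnegative for every unimodular `c` and every `r < 1`. -/
theorem re_two_mul_add_taylorCoeff_nonneg {q : ℂ → ℂ} (hq : DifferentiableOn ℂ q unitDisk)
    (hre : ∀ z ∈ unitDisk, 0 ≤ (q z).re) {n : ℕ} (hn : n ≠ 0) {c : ℂ} (hc : ‖c‖ = 1)
    {r : ℝ} (hr0 : 0 < r) (hr1 : r < 1) :
    0 ≤ (2 * q 0 + c * r ^ n * taylorCoeff q n).re := by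
  have hsub : closedBall (0 : ℂ) r ⊆ unitDisk := closedBall_subset_ball hr1
  have hrc : (r : ℂ) ≠ 0 := by exact_mod_cast hr0.ne'
  have hc0 : c ≠ 0 := by rintro rfl; simp at hc
  have hqr : DifferentiableOn ℂ q (closedBall 0 r) := hq.mono hsub
  have hsph : sphere (0 : ℂ) r ⊆ closedBall 0 r := sphere_subset_closedBall
  have hne : ∀ z ∈ sphere (0 : ℂ) r, z ≠ 0 := fun z hz h ↦ by
    simp [h, hr0.ne] at hz
  -- Averaged over |z| = r, `A` gives 2 q(0) by the mean value property and `B` gives the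
  -- coefficient term by Cauchy's formula. On the circle their sum is (2 + v + v̄) q with |v| = 1, a
  -- nonnegative real multiple of q.
  set A : ℂ → ℂ := fun z ↦ q z * (2 + c⁻¹ * z ^ n / r ^ n) with hA
  set B : ℂ → ℂ := fun z ↦ (c * r ^ n) • (1 / z ^ n * q z) with hB
  have hAd : DifferentiableOn ℂ A (closedBall 0 r) := hqr.mul (by fun_prop)
  have hAi : CircleIntegrable A 0 r := (hAd.continuousOn.mono hsph).circleIntegrable hr0.le
  have hBi : CircleIntegrable B 0 r := by
    refine ContinuousOn.circleIntegrable hr0.le ?_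
    refine continuousOn_const.mul (ContinuousOn.mul (ContinuousOn.div continuousOn_const (by fun_prop) ?_)
      (hqr.continuousOn.mono hsph))
    exact fun z hz ↦ pow_ne_zero _ (hne z hz)
  have hAavg : Real.circleAverage A 0 r = 2 * q 0 := by
    have hAd' : DiffContOnCl ℂ A (ball 0 |r|) := by
      rw [abs_of_pos hr0]
      exact (hAd.mono closure_ball_subset_closedBall).diffContOnCl
    rw [hAd'.circleAverage]
    simp [hA, hn, mul_comm]
  have hBavg : Real.circleAverage B 0 r = c * r ^ n * taylorCoeff q n := by
    rw [hB, Real.circleAverage_fun_smul, Real.circleAverage_eq_circleIntegral hr0.ne', smul_eq_mul,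
      smul_eq_mul]
    congr 1
    have h := hqr.circleIntegral_one_div_sub_center_pow_smul hr0 n
    have : ∀ z : ℂ, (z - 0)⁻¹ • (1 / z ^ n * q z) = (1 / (z - 0) ^ (n + 1)) • q z := by
      intro z
      simp only [sub_zero, smul_eq_mul, pow_succ, one_div, mul_inv]
      ring
    simp only [this]
    rw [h, taylorCoeff, smul_eq_mul]
    have := Complex.two_pi_I_ne_zero
    field_simp
  have hsum : Real.circleAverage (A + B) 0 r = 2 * q 0 + c * r ^ n * taylorCoeff q n := by
    rw [Real.circleAverage_add hAi hBi, hAavg, hBavg]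
  have hre' := Complex.reCLM.circleAverage_comp_comm (hAi.add hBi)
  rw [hsum] at hre'
  rw [← Complex.reCLM_apply, ← hre']
  refine Real.circleAverage_nonneg_of_nonneg fun z hz ↦ ?_
  rw [abs_of_pos hr0] at hz
  have hz0 := hne z hz
  have hzn : ‖z‖ = r := by simpa using hz
  set v : ℂ := c⁻¹ * z ^ n / r ^ n with hv
  have hv1 : ‖v‖ = 1 := by
    simp [hv, hc, hzn, abs_of_pos hr0, hr0.ne']
  have hvi : c * r ^ n / z ^ n = (starRingEnd ℂ) v := by
    rw [← Complex.inv_eq_conj hv1, hv]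
    field_simp
  have hval : (A + B) z = ((2 + 2 * v.re : ℝ) : ℂ) * q z := by
    have : (A + B) z = (2 + (v + c * r ^ n / z ^ n)) * q z := by
      simp only [hA, hB, Pi.add_apply, smul_eq_mul, ← hv]
      ring
    rw [this, hvi, Complex.add_conj]
    push_cast
    ring
  rw [Function.comp_apply, hval, Complex.reCLM_apply, Complex.re_ofReal_mul]
  have := (abs_le.1 (Complex.abs_re_le_norm v)).1
  exact mul_nonneg (by linarith) (hre z (hsub (hsph hz)))

/-- **Carathéodory's coefficient inequality** for functions with nonnegative real part. -/
theorem norm_taylorCoeff_le_of_re_nonneg {q : ℂ → ℂ} (hq : DifferentiableOn ℂ q unitDisk)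
    (hre : ∀ z ∈ unitDisk, 0 ≤ (q z).re) {n : ℕ} (hn : n ≠ 0) :
    ‖taylorCoeff q n‖ ≤ 2 * (q 0).re := by
  set a := taylorCoeff q n with ha
  by_cases ha0 : a = 0
  · have := hre 0 (by simp [unitDisk])
    simpa [ha0] using this
  have hna : (‖a‖ : ℂ) ≠ 0 := by simpa using ha0
  have hbound : ∀ r ∈ Set.Ioo (0 : ℝ) 1, r ^ n * ‖a‖ ≤ 2 * (q 0).re := by
    intro r hr
    -- This phase turns c * a into -‖a‖.
    have hc : ‖-(starRingEnd ℂ a) / ‖a‖‖ = 1 := by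
      simp [ha0]
    have h := re_two_mul_add_taylorCoeff_nonneg hq hre hn hc hr.1 hr.2
    have hval : -(starRingEnd ℂ a) / ‖a‖ * r ^ n * taylorCoeff q n
        = ((-(r ^ n * ‖a‖) : ℝ) : ℂ) := by
      have := Complex.conj_mul' a
      rw [← ha]
      push_cast
      field_simp
      linear_combination (-(r : ℂ) ^ n) * this
    rw [hval, Complex.add_re, Complex.ofReal_re] at h
    simp at h
    linarith
  have hlim : Filter.Tendsto (fun r : ℝ ↦ r ^ n * ‖a‖) (nhdsWithin 1 (Set.Iio 1)) (nhds ‖a‖) := by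
    have : Continuous fun r : ℝ ↦ r ^ n * ‖a‖ := by fun_prop
    simpa using (this.tendsto 1).mono_left nhdsWithin_le_nhds
  refine le_of_tendsto hlim ?_
  filter_upwards [Ioo_mem_nhdsLT (zero_lt_one' ℝ)] with r hr using hbound r hr

/-! ### Injectivity -/

/-- The Noshiro–Warschawski criterion: a function whose derivative has positive real part on a
convex set is injective there. -/
theorem Convex.injOn_of_re_deriv_pos {S : Set ℂ} (hS : Convex ℝ S) {g g' : ℂ → ℂ}
    (hg : ∀ w ∈ S, HasDerivAt g (g' w) w) (hpos : ∀ w ∈ S, 0 < (g' w).re) : Set.InjOn g S := by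
  intro a ha b hb hab
  by_contra hne
  set d : ℂ := b - a with hd
  have hd0 : d ≠ 0 := sub_ne_zero.2 (Ne.symm hne)
  have hmem : ∀ t ∈ Set.Icc (0 : ℝ) 1, a + t * d ∈ S := by
    intro t ht
    simpa using hS.add_smul_sub_mem ha hb ht
  -- Rolle's theorem needs a real function: multiplying by the conjugate of d makes the derivative
  -- along the segment |d|² Re g'.
  set u : ℝ → ℝ := fun t ↦ (g (a + t * d) * (starRingEnd ℂ) d).re with hu
  have hu' : ∀ t ∈ Set.Icc (0 : ℝ) 1,
      HasDerivAt u (Complex.normSq d * (g' (a + t * d)).re) t := by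
    intro t ht
    have h1 : HasDerivAt (fun s : ℂ ↦ a + s * d) d t := by
      simpa using ((hasDerivAt_id (t : ℂ)).mul_const d).const_add a
    have h2 := ((hg _ (hmem t ht)).comp (t : ℂ) h1).mul_const ((starRingEnd ℂ) d)
    refine h2.real_of_complex.congr_deriv ?_
    rw [mul_assoc, Complex.mul_conj, mul_comm, Complex.re_ofReal_mul]
  obtain ⟨t, ht, hzero⟩ := exists_hasDerivAt_eq_zero (zero_lt_one' ℝ)
    (fun t ht ↦ (hu' t ht).continuousAt.continuousWithinAt) (by simp [hu, hd, hab])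
    (fun t ht ↦ hu' t (Set.Ioo_subset_Icc_self ht))
  have := hpos _ (hmem t (Set.Ioo_subset_Icc_self ht))
  exact (mul_pos (Complex.normSq_pos.2 hd0) this).ne' hzero

theorem one_sub_ne_zero_of_mem_unitDisk {z : ℂ} (hz : z ∈ unitDisk) : 1 - z ≠ 0 := by
  intro h
  rw [← sub_eq_zero.1 h] at hz
  simp [unitDisk] at hz

theorem isOpen_unitDisk : IsOpen unitDisk := Metric.isOpen_ball

theorem zero_mem_unitDisk : (0 : ℂ) ∈ unitDisk := by simp [unitDisk]

/-- The map `w ↦ w / (1 + w)` sends the half-plane `Re w > -1/2` into the unit disk. -/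
theorem div_one_add_mem_unitDisk {w : ℂ} (hw : -(1 / 2) < w.re) : w / (1 + w) ∈ unitDisk := by
  have h1 : 1 + w ≠ 0 := fun h ↦ by
    have := congrArg Complex.re h
    simp at this
    linarith
  rw [unitDisk, mem_ball_zero_iff, norm_div, div_lt_one (norm_pos_iff.2 h1),
    ← sq_lt_sq₀ (norm_nonneg _) (norm_nonneg _), ← Complex.normSq_eq_norm_sq,
    ← Complex.normSq_eq_norm_sq, Complex.normSq_apply, Complex.normSq_apply]
  simp
  nlinarith

/-- The map `z ↦ z / (1 - z)` sends the unit disk into the half-plane `Re w > -1/2`. -/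
theorem re_div_one_sub_of_mem_unitDisk {z : ℂ} (hz : z ∈ unitDisk) :
    -(1 / 2) < (z / (1 - z)).re := by
  have h1 := one_sub_ne_zero_of_mem_unitDisk hz
  have h2 : 0 < Complex.normSq (1 - z) := Complex.normSq_pos.2 h1
  have h3 : Complex.normSq z < 1 := by
    rw [unitDisk, mem_ball_zero_iff] at hz
    rw [Complex.normSq_eq_norm_sq]
    exact pow_lt_one₀ (norm_nonneg _) hz two_ne_zero
  rw [Complex.div_re, ← add_div, lt_div_iff₀ h2]
  rw [Complex.normSq_apply] at *
  simp at *
  nlinarith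

/-- With z = w / (1 + w), dz/dw = (1 - z)², so the defining condition says that f, read in the
coordinate w on a half-plane, has derivative of positive real part. -/
theorem ClassF4.injOn {f : ℂ → ℂ} (hf : f ∈ ClassF4) : Set.InjOn f unitDisk := by
  set S : Set ℂ := {w | -(1 / 2) < w.re}
  have hS : Convex ℝ S := convex_halfSpace_re_gt _
  have hne : ∀ w ∈ S, 1 + w ≠ 0 := fun w hw h ↦ by
    have h1 := congrArg Complex.re h
    have h2 : -(1 / 2) < w.re := hw
    simp at h1
    linarith
  have hinj : Set.InjOn (fun w ↦ f (w / (1 + w))) S := by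
    refine hS.injOn_of_re_deriv_pos
      (g' := fun w ↦ (1 - w / (1 + w)) ^ 2 * deriv f (w / (1 + w))) (fun w hw ↦ ?_)
      fun w hw ↦ hf.2 _ (div_one_add_mem_unitDisk hw)
    have h1 := hne w hw
    have hd := (hasDerivAt_id w).div ((hasDerivAt_id w).const_add 1) h1
    have hfd := (hf.1.1 _ (div_one_add_mem_unitDisk hw)).differentiableAt.hasDerivAt
    refine (hfd.comp w hd).congr_deriv ?_
    simp only [id]
    field_simp
    ring
  have key : ∀ z ∈ unitDisk, z / (1 - z) / (1 + z / (1 - z)) = z := fun z hz ↦ by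
    have := one_sub_ne_zero_of_mem_unitDisk hz
    have h2 : 1 + z / (1 - z) = 1 / (1 - z) := by field_simp; ring
    rw [h2]
    field_simp
  intro a ha b hb hab
  have h := hinj (re_div_one_sub_of_mem_unitDisk ha) (re_div_one_sub_of_mem_unitDisk hb)
    (by simpa only [key a ha, key b hb] using hab)
  rw [← key a ha, ← key b hb, h]

/-! ### Derivatives of the inverse function -/

section Inverse

open Filter Topology

variable {f : ℂ → ℂ}

theorem diskInverse_apply (hinj : Set.InjOn f unitDisk) {z : ℂ} (hz : z ∈ unitDisk) :
    diskInverse f (f z) = z :=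
  hinj.leftInvOn_invFunOn hz

theorem map_nhds_of_deriv_ne_zero (hf : AnalyticOnNhd ℂ f unitDisk)
    (hne : ∀ z ∈ unitDisk, deriv f z ≠ 0) {z : ℂ} (hz : z ∈ unitDisk) :
    map f (𝓝 z) = 𝓝 (f z) :=
  (hf z hz).hasStrictDerivAt.map_nhds_eq (hne z hz)

theorem hasDerivAt_diskInverse (hf : AnalyticOnNhd ℂ f unitDisk) (hinj : Set.InjOn f unitDisk)
    (hne : ∀ z ∈ unitDisk, deriv f z ≠ 0) {z : ℂ} (hz : z ∈ unitDisk) :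
    HasDerivAt (diskInverse f) (deriv f z)⁻¹ (f z) := by
  have hev : ∀ᶠ z' in 𝓝 z, diskInverse f (f z') = z' := by
    filter_upwards [isOpen_unitDisk.mem_nhds hz] with z' hz' using diskInverse_apply hinj hz'
  have hfz := diskInverse_apply hinj hz
  refine HasDerivAt.of_local_left_inverse (f := f) ?_ ?_ (hne z hz) ?_
  · rw [ContinuousAt, ← map_nhds_of_deriv_ne_zero hf hne hz, hfz, tendsto_map'_iff]
    exact tendsto_id.congr' (hev.mono fun _ h ↦ h.symm)
  · rw [hfz]
    exact (hf z hz).differentiableAt.hasDerivAt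
  · rw [← map_nhds_of_deriv_ne_zero hf hne hz, eventually_map]
    filter_upwards [hev] with z' h
    rw [h]

theorem analyticAt_diskInverse (hf : AnalyticOnNhd ℂ f unitDisk) (hinj : Set.InjOn f unitDisk)
    (hne : ∀ z ∈ unitDisk, deriv f z ≠ 0) {z : ℂ} (hz : z ∈ unitDisk) :
    AnalyticAt ℂ (diskInverse f) (f z) := by
  rw [Complex.analyticAt_iff_eventually_differentiableAt,
    ← map_nhds_of_deriv_ne_zero hf hne hz, eventually_map]
  filter_upwards [isOpen_unitDisk.mem_nhds hz] with z' hz'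
  exact (hasDerivAt_diskInverse hf hinj hne hz').differentiableAt

/-- One application of ψ ↦ φ ψ', obtained by the chain rule from g⁽ⁿ⁾ = ψ ∘ g near f(z). -/
theorem iteratedDeriv_succ_diskInverse (hf : AnalyticOnNhd ℂ f unitDisk)
    (hinj : Set.InjOn f unitDisk) (hne : ∀ z ∈ unitDisk, deriv f z ≠ 0) {n : ℕ} {ψ ψ' : ℂ → ℂ}
    (hψ : ∀ z ∈ unitDisk, iteratedDeriv n (diskInverse f) (f z) = ψ z)
    (hψ' : ∀ z ∈ unitDisk, HasDerivAt ψ (ψ' z) z) :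
    ∀ z ∈ unitDisk, iteratedDeriv (n + 1) (diskInverse f) (f z) = ψ' z * (deriv f z)⁻¹ := by
  intro z hz
  have hev : iteratedDeriv n (diskInverse f) =ᶠ[𝓝 (f z)] ψ ∘ diskInverse f := by
    rw [← map_nhds_of_deriv_ne_zero hf hne hz, EventuallyEq, eventually_map]
    filter_upwards [isOpen_unitDisk.mem_nhds hz] with z' hz'
    rw [hψ z' hz', Function.comp_apply, diskInverse_apply hinj hz']
  rw [iteratedDeriv_succ, hev.deriv_eq]
  refine (HasDerivAt.comp (f z) ?_ (hasDerivAt_diskInverse hf hinj hne hz)).deriv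
  rw [diskInverse_apply hinj hz]
  exact hψ' z hz

/-- The second to fifth inverse coefficients in terms of the Taylor coefficients of `1 / f'`. -/
theorem inverseCoeff_eq (hf : f ∈ ClassA) (hinj : Set.InjOn f unitDisk)
    (hne : ∀ z ∈ unitDisk, deriv f z ≠ 0) {b : ℕ → ℂ}
    (hb : ∀ n, b n = taylorCoeff (fun z ↦ (deriv f z)⁻¹) n) :
    inverseCoeff f 2 = b 1 / 2 ∧
    inverseCoeff f 3 = (2 * b 2 + b 1 ^ 2) / 6 ∧
    inverseCoeff f 4 = (6 * b 3 + 8 * b 1 * b 2 + b 1 ^ 3) / 24 ∧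
    inverseCoeff f 5 = (24 * b 4 + 42 * b 1 * b 3 + 16 * b 2 ^ 2 + 22 * b 1 ^ 2 * b 2
      + b 1 ^ 4) / 120 := by
  obtain ⟨han, hf0, hf1⟩ := hf
  set φ : ℂ → ℂ := fun z ↦ (deriv f z)⁻¹ with hφ
  have hφan : AnalyticOnNhd ℂ φ unitDisk := fun z hz ↦ (han.deriv z hz).inv (hne z hz)
  set d : ℕ → ℂ → ℂ := fun k ↦ iteratedDeriv k φ with hd
  have hD : ∀ k, ∀ z ∈ unitDisk, HasDerivAt (d k) (d (k + 1) z) z := by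
    intro k z hz
    simp only [hd, iteratedDeriv_succ]
    refine DifferentiableAt.hasDerivAt ?_
    rw [iteratedDeriv_eq_iterate]
    exact (hφan.iterated_deriv k z hz).differentiableAt
  have step := @iteratedDeriv_succ_diskInverse f han hinj hne
  have hφd : ∀ z, (deriv f z)⁻¹ = d 0 z := fun z ↦ by simp [hd, hφ]
  simp only [hφd] at step
  have h1 := step (n := 0) (ψ := id) (ψ' := fun _ ↦ 1)
    (fun z hz ↦ by simpa using diskInverse_apply hinj hz) fun z _ ↦ hasDerivAt_id z
  have h2 := step h1 fun z hz ↦ (hD 0 z hz).const_mul 1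
  have h3 := step h2 fun z hz ↦ ((hD 1 z hz).const_mul 1).mul (hD 0 z hz)
  have h4 := step h3 fun z hz ↦ ((((hD 2 z hz).const_mul 1).mul (hD 0 z hz)).add
    (((hD 1 z hz).const_mul 1).mul (hD 1 z hz))).mul (hD 0 z hz)
  -- Like terms are collected before the last differentiation to keep it short.
  have h4' : ∀ z ∈ unitDisk, iteratedDeriv 4 (diskInverse f) (f z) =
      d 3 z * d 0 z ^ 3 + 4 * (d 0 z ^ 2 * d 1 z * d 2 z) + d 1 z ^ 3 * d 0 z := by
    intro z hz
    rw [h4 z hz]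
    simp only [Pi.mul_apply, Pi.add_apply]
    ring
  have h5 := step h4' fun z hz ↦ (((hD 3 z hz).mul ((hD 0 z hz).pow 3)).add
    (((((hD 0 z hz).pow 2).mul (hD 1 z hz)).mul (hD 2 z hz)).const_mul 4)).add
    (((hD 1 z hz).pow 3).mul (hD 0 z hz))
  have hz0 := zero_mem_unitDisk
  have hd0 : d 0 0 = 1 := by simp [hd, hφ, hf1]
  have hbd : ∀ n, b n = d n 0 / n.factorial := hb
  have h2 := h2 0 hz0
  have h3 := h3 0 hz0
  have h4 := h4' 0 hz0
  have h5 := h5 0 hz0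
  simp only [Pi.mul_apply, Pi.pow_apply, hf0, hd0, zero_add, Nat.reduceAdd] at h2 h3 h4 h5
  simp only [inverseCoeff, taylorCoeff, hbd, h2, h3, h4, h5, Nat.factorial]
  push_cast
  refine ⟨?_, ?_, ?_, ?_⟩ <;> ring

end Inverse

/-! ### Coefficients of 1 / f' -/

/-- Multiplication by `(1 - z)²` acts on Taylor coefficients by taking second differences. -/
theorem taylorCoeff_one_sub_sq_mul {q : ℂ → ℂ} (hq : AnalyticAt ℂ q 0) :
    taylorCoeff (fun z ↦ (1 - z) ^ 2 * q z) 1 = taylorCoeff q 1 - 2 * taylorCoeff q 0 ∧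
    ∀ n, taylorCoeff (fun z ↦ (1 - z) ^ 2 * q z) (n + 2) =
      taylorCoeff q (n + 2) - 2 * taylorCoeff q (n + 1) + taylorCoeff q n := by
  have hp : ∀ n : ℕ, ContDiffAt ℂ n (fun z : ℂ ↦ (1 - z) ^ 2) 0 := fun n ↦ by fun_prop
  have hd1 : deriv (fun z : ℂ ↦ (1 - z) ^ 2) = fun z ↦ -2 + 2 * z := by
    ext z
    have h := ((hasDerivAt_id z).const_sub 1).pow 2
    refine h.deriv.trans ?_
    simp only [id]
    ring
  have hd2 : deriv (fun z : ℂ ↦ -2 + 2 * z) = fun _ ↦ 2 := by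
    ext z
    simp
  have e2 : ∀ n, iteratedDeriv (n + 2) (fun z : ℂ ↦ (1 - z) ^ 2) 0 = if n = 0 then 2 else 0 := by
    intro n
    rw [iteratedDeriv_succ', iteratedDeriv_succ', hd1, hd2, iteratedDeriv_const]
  have e0 : iteratedDeriv 0 (fun z : ℂ ↦ (1 - z) ^ 2) 0 = 1 := by simp
  have e1 : iteratedDeriv 1 (fun z : ℂ ↦ (1 - z) ^ 2) 0 = -2 := by simp [hd1]
  constructor
  · rw [taylorCoeff, iteratedDeriv_fun_mul (hp 1) hq.contDiffAt]
    simp only [Finset.sum_range_succ, Finset.sum_range_zero, e0, e1]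
    simp [taylorCoeff]
    ring
  · intro n
    rw [taylorCoeff, iteratedDeriv_fun_mul (hp _) hq.contDiffAt, Finset.sum_range_succ',
      Finset.sum_range_succ', Finset.sum_range_succ']
    -- In the Leibniz sum, three or more derivatives kill (1 - z)².
    rw [Finset.sum_eq_zero fun i _ ↦ by rw [e2]; simp]
    simp only [zero_add, e0, e1, e2 0]
    have hc : (((n + 2).choose 2 : ℕ) : ℂ) = (n + 2) * (n + 1) / 2 := by
      rw [Nat.cast_choose_two]
      push_cast
      ring
    have hn1 : (n : ℂ) + 1 ≠ 0 := by exact_mod_cast n.succ_ne_zero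
    have hn2 : (n : ℂ) + 2 ≠ 0 := by exact_mod_cast (n + 1).succ_ne_zero
    have hf : (n.factorial : ℂ) ≠ 0 := by exact_mod_cast n.factorial_ne_zero
    simp only [taylorCoeff, hc, Nat.factorial_succ, Nat.choose_zero_right, Nat.choose_one_right,
      show n + 2 - 0 = n + 2 from rfl, show n + 2 - 1 = n + 1 from rfl,
      show n + 2 - 2 = n from rfl]
    push_cast
    have hn2' : (n : ℂ) + 1 + 1 ≠ 0 := by rwa [add_assoc, one_add_one_eq_two]
    field_simp
    ring

theorem ClassF4.deriv_ne_zero {f : ℂ → ℂ} (hf : f ∈ ClassF4) : ∀ z ∈ unitDisk, deriv f z ≠ 0 := by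
  intro z hz h
  simpa [h] using hf.2 z hz

/-- The Taylor coefficients of `1 / f'` for `f` in the class, as second differences of those of
`1 / ((1 - z)² f')`. -/
theorem ClassF4.taylorCoeff_inv_deriv {f q : ℂ → ℂ} (hf : f ∈ ClassF4)
    (hq : ∀ z ∈ unitDisk, q z = ((1 - z) ^ 2 * deriv f z)⁻¹) :
    AnalyticOnNhd ℂ q unitDisk ∧
    taylorCoeff (fun z ↦ (deriv f z)⁻¹) 1 = taylorCoeff q 1 - 2 ∧
    taylorCoeff (fun z ↦ (deriv f z)⁻¹) 2 = taylorCoeff q 2 - 2 * taylorCoeff q 1 + 1 ∧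
    ∀ n, taylorCoeff (fun z ↦ (deriv f z)⁻¹) (n + 3) =
      taylorCoeff q (n + 3) - 2 * taylorCoeff q (n + 2) + taylorCoeff q (n + 1) := by
  have hqan : AnalyticOnNhd ℂ q unitDisk := by
    have hp : AnalyticOnNhd ℂ (fun z ↦ (1 - z) ^ 2 * deriv f z) unitDisk := fun z hz ↦
      ((analyticAt_const.sub analyticAt_id).pow 2).mul (hf.1.1.deriv z hz)
    have hinv : AnalyticOnNhd ℂ (fun z ↦ ((1 - z) ^ 2 * deriv f z)⁻¹) unitDisk := fun z hz ↦
      (hp z hz).inv (mul_ne_zero (pow_ne_zero 2 (one_sub_ne_zero_of_mem_unitDisk hz))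
        (ClassF4.deriv_ne_zero hf z hz))
    exact hinv.congr isOpen_unitDisk fun z hz ↦ (hq z hz).symm
  have hev : (fun z ↦ (deriv f z)⁻¹) =ᶠ[nhds 0] fun z ↦ (1 - z) ^ 2 * q z := by
    filter_upwards [isOpen_unitDisk.mem_nhds zero_mem_unitDisk] with z hz
    have h1 := one_sub_ne_zero_of_mem_unitDisk hz
    have h2 := ClassF4.deriv_ne_zero hf z hz
    rw [hq z hz]
    field_simp
  have hb : ∀ n, taylorCoeff (fun z ↦ (deriv f z)⁻¹) n =
      taylorCoeff (fun z ↦ (1 - z) ^ 2 * q z) n := fun n ↦ by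
    rw [taylorCoeff, hev.iteratedDeriv_eq, taylorCoeff]
  have hq0 : taylorCoeff q 0 = 1 := by
    simp [taylorCoeff, hq 0 zero_mem_unitDisk, hf.1.2.2]
  obtain ⟨h1, h2⟩ := taylorCoeff_one_sub_sq_mul (hqan 0 zero_mem_unitDisk)
  refine ⟨hqan, ?_, ?_, fun n ↦ ?_⟩
  · rw [hb, h1, hq0, mul_one]
  · rw [hb, h2 0, hq0]
  · rw [hb, h2 (n + 1)]

/-! ### The four bounds -/

theorem norm_inverseCoeff_le {f : ℂ → ℂ} (hf : f ∈ ClassF4) :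
    ‖inverseCoeff f 2‖ ≤ 2 ∧ ‖inverseCoeff f 3‖ ≤ 5 ∧ ‖inverseCoeff f 4‖ ≤ 14 ∧
      ‖inverseCoeff f 5‖ ≤ 42 := by
  set q : ℂ → ℂ := fun z ↦ ((1 - z) ^ 2 * deriv f z)⁻¹ with hq
  obtain ⟨hqan, e1, e2, e3⟩ := ClassF4.taylorCoeff_inv_deriv hf (q := q) fun _ _ ↦ rfl
  have hre : ∀ z ∈ unitDisk, 0 ≤ (q z).re := fun z hz ↦ by
    rw [hq, Complex.inv_re]
    exact div_nonneg (hf.2 z hz).le (Complex.normSq_nonneg _)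
  have hqn : ∀ n, n ≠ 0 → ‖taylorCoeff q n‖ ≤ 2 := fun n hn ↦ by
    simpa [hq, hf.1.2.2] using
      norm_taylorCoeff_le_of_re_nonneg hqan.differentiableOn hre hn
  have hdiff : ∀ x y w : ℂ, ‖x - 2 * y + w‖ ≤ ‖x‖ + 2 * ‖y‖ + ‖w‖ := fun x y w ↦ by
    refine (norm_add_le _ _).trans (add_le_add_left ((norm_sub_le _ _).trans ?_) _)
    simp
  set b : ℕ → ℂ := taylorCoeff fun z ↦ (deriv f z)⁻¹
  have q1 := hqn 1 (by simp)
  have q2 := hqn 2 (by simp)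
  have q3 := hqn 3 (by simp)
  have q4 := hqn 4 (by simp)
  -- Here q₀ = 1 rather than 2 enters: 2 + 2, then 2 + 4 + 1, and from b₃ on 2 + 4 + 2.
  have b1 : ‖b 1‖ ≤ 4 := by
    rw [e1]
    refine (norm_sub_le _ _).trans ?_
    norm_num
    linarith
  have b2 : ‖b 2‖ ≤ 7 := by
    rw [e2]
    refine (hdiff _ _ _).trans ?_
    rw [norm_one]
    linarith
  have b3 : ‖b 3‖ ≤ 8 := by
    rw [e3 0]
    refine (hdiff _ _ _).trans ?_
    simp only [zero_add]
    linarith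
  have b4 : ‖b 4‖ ≤ 8 := by
    rw [e3 1]
    refine (hdiff _ _ _).trans ?_
    simp only [Nat.reduceAdd]
    linarith
  obtain ⟨h2, h3, h4, h5⟩ := inverseCoeff_eq hf.1 (ClassF4.injOn hf) (ClassF4.deriv_ne_zero hf)
    (b := b) fun _ ↦ rfl
  rw [h2, h3, h4, h5]
  refine ⟨?_, ?_, ?_, ?_⟩
  · calc ‖b 1 / 2‖ = ‖b 1‖ / 2 := by simp
      _ ≤ 4 / 2 := by gcongr
      _ = 2 := by norm_num
  · calc ‖(2 * b 2 + b 1 ^ 2) / 6‖ = ‖2 * b 2 + b 1 ^ 2‖ / 6 := by simp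
      _ ≤ (2 * ‖b 2‖ + ‖b 1‖ ^ 2) / 6 := by
        gcongr
        exact (norm_add_le _ _).trans_eq (by simp)
      _ ≤ (2 * 7 + 4 ^ 2) / 6 := by gcongr
      _ = 5 := by norm_num
  · calc ‖(6 * b 3 + 8 * b 1 * b 2 + b 1 ^ 3) / 24‖
        = ‖6 * b 3 + 8 * b 1 * b 2 + b 1 ^ 3‖ / 24 := by simp
      _ ≤ (6 * ‖b 3‖ + 8 * ‖b 1‖ * ‖b 2‖ + ‖b 1‖ ^ 3) / 24 := by
        gcongr
        exact norm_add₃_le.trans_eq (by simp)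
      _ ≤ (6 * 8 + 8 * 4 * 7 + 4 ^ 3) / 24 := by gcongr
      _ = 14 := by norm_num
  · calc ‖(24 * b 4 + 42 * b 1 * b 3 + 16 * b 2 ^ 2 + 22 * b 1 ^ 2 * b 2 + b 1 ^ 4) / 120‖
        = ‖24 * b 4 + 42 * b 1 * b 3 + 16 * b 2 ^ 2 + 22 * b 1 ^ 2 * b 2 + b 1 ^ 4‖ / 120 := by
          simp
      _ ≤ (24 * ‖b 4‖ + 42 * ‖b 1‖ * ‖b 3‖ + 16 * ‖b 2‖ ^ 2 + 22 * ‖b 1‖ ^ 2 * ‖b 2‖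
          + ‖b 1‖ ^ 4) / 120 := by
        gcongr
        refine (norm_add_le _ _).trans ((add_le_add_left norm_add₄_le _).trans_eq ?_)
        simp
      _ ≤ (24 * 8 + 42 * 4 * 8 + 16 * 7 ^ 2 + 22 * 4 ^ 2 * 7 + 4 ^ 4) / 120 := by gcongr
      _ = 42 := by norm_num

/-! ### Sharpness -/

section Koebe

/-- The Koebe function `z / (1 - z)²`. -/
noncomputable def koebe (z : ℂ) : ℂ := z / (1 - z) ^ 2

theorem hasDerivAt_koebe {z : ℂ} (hz : 1 - z ≠ 0) :
    HasDerivAt koebe ((1 + z) / (1 - z) ^ 3) z := by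
  have h := (hasDerivAt_id z).div (((hasDerivAt_id z).const_sub 1).pow 2) (pow_ne_zero 2 hz)
  refine h.congr_deriv ?_
  simp only [id, Pi.pow_apply]
  field_simp
  ring

theorem deriv_koebe {z : ℂ} (hz : z ∈ unitDisk) : deriv koebe z = (1 + z) / (1 - z) ^ 3 :=
  (hasDerivAt_koebe (one_sub_ne_zero_of_mem_unitDisk hz)).deriv

theorem koebe_mem_classF4 : koebe ∈ ClassF4 := by
  refine ⟨⟨?_, by simp [koebe], by simp [deriv_koebe zero_mem_unitDisk]⟩, fun z hz ↦ ?_⟩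
  · refine DifferentiableOn.analyticOnNhd (fun z hz ↦ ?_) isOpen_unitDisk
    exact (hasDerivAt_koebe
      (one_sub_ne_zero_of_mem_unitDisk hz)).differentiableAt.differentiableWithinAt
  · have h1 := one_sub_ne_zero_of_mem_unitDisk hz
    have h2 := re_div_one_sub_of_mem_unitDisk hz
    have h3 : (1 - z) ^ 2 * deriv koebe z = 1 + (2 : ℝ) * (z / (1 - z)) := by
      rw [deriv_koebe hz]
      push_cast
      field_simp
      ring
    rw [h3, Complex.add_re, Complex.re_ofReal_mul, Complex.one_re]
    linarith

theorem taylorCoeff_koebe_two : taylorCoeff koebe 2 = 2 := by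
  have hev : deriv koebe =ᶠ[nhds 0] fun z ↦ (1 + z) / (1 - z) ^ 3 := by
    filter_upwards [isOpen_unitDisk.mem_nhds zero_mem_unitDisk] with z hz using deriv_koebe hz
  have h := ((hasDerivAt_id (0 : ℂ)).const_add 1).div
    (((hasDerivAt_id (0 : ℂ)).const_sub 1).pow 3) (by simp)
  have h4 : deriv (fun z : ℂ ↦ (1 + z) / (1 - z) ^ 3) 0 = 4 := by
    refine h.deriv.trans ?_
    norm_num
  rw [taylorCoeff, iteratedDeriv_succ', iteratedDeriv_one, hev.deriv_eq, h4]
  norm_num [Nat.factorial]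

theorem taylorCoeff_two_mul_inv_one_add_sub_one (n : ℕ) :
    taylorCoeff (fun z ↦ -1 + 2 * (1 + z)⁻¹) (n + 1) = 2 * (-1) ^ (n + 1) := by
  rw [taylorCoeff, iteratedDeriv_const_add n.succ_pos, iteratedDeriv_const_mul_field,
    iteratedDeriv_comp_const_add, iteratedDeriv_eq_iterate]
  simp only [iter_deriv_inv]
  have := Nat.factorial_ne_zero (n + 1)
  simp
  field_simp

/-- Here b₁, …, b₄ = -4, 7, -8, 8. The signs alternate with the index, so all monomials in a given
δₙ, having equal weight, share a sign and nothing cancels. -/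
theorem norm_inverseCoeff_koebe :
    ‖inverseCoeff koebe 2‖ = 2 ∧ ‖inverseCoeff koebe 3‖ = 5 ∧ ‖inverseCoeff koebe 4‖ = 14 ∧
      ‖inverseCoeff koebe 5‖ = 42 := by
  have hf := koebe_mem_classF4
  obtain ⟨-, e1, e2, e3⟩ := ClassF4.taylorCoeff_inv_deriv hf
    -- This is (1 - z) / (1 + z), split so that its coefficients 2 (-1)ⁿ can be read off.
    (q := fun z ↦ -1 + 2 * (1 + z)⁻¹) fun z hz ↦ by
      have h1 := one_sub_ne_zero_of_mem_unitDisk hz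
      have h2 : 1 + z ≠ 0 := by
        have := one_sub_ne_zero_of_mem_unitDisk (z := -z) (by simpa [unitDisk] using hz)
        simpa using this
      rw [deriv_koebe hz]
      field_simp
      ring
  have e4 := e3 1
  have e3 := e3 0
  have t1 := taylorCoeff_two_mul_inv_one_add_sub_one 0
  have t2 := taylorCoeff_two_mul_inv_one_add_sub_one 1
  have t3 := taylorCoeff_two_mul_inv_one_add_sub_one 2
  have t4 := taylorCoeff_two_mul_inv_one_add_sub_one 3
  simp only [zero_add, Nat.reduceAdd] at e3 e4 t1 t2 t3 t4
  rw [t1] at e1 e2 e3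
  rw [t2] at e2 e3 e4
  rw [t3] at e3 e4
  rw [t4] at e4
  obtain ⟨h2, h3, h4, h5⟩ := inverseCoeff_eq hf.1 (ClassF4.injOn hf) (ClassF4.deriv_ne_zero hf)
    fun _ ↦ rfl
  rw [h2, h3, h4, h5, e1, e2, e3, e4]
  norm_num

end Koebe

theorem mainTheorem5 :
    (∀ f ∈ ClassF4,
      (Set.InjOn f unitDisk ∧ AnalyticAt ℂ (diskInverse f) 0) ∧
      ‖inverseCoeff f 2‖ ≤ 2 ∧
      ‖inverseCoeff f 3‖ ≤ 5 ∧
      ((taylorCoeff f 2).im = 0 →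
        ‖inverseCoeff f 4‖ ≤ 14 ∧ ‖inverseCoeff f 5‖ ≤ 42)) ∧
    (∃ f ∈ ClassF4,
      (∀ z ∈ unitDisk,
        z * deriv f z = z / (1 - z) ^ 2 * ((1 + z) / (1 - z))) ∧
      (taylorCoeff f 2).im = 0 ∧
      ‖inverseCoeff f 2‖ = 2 ∧
      ‖inverseCoeff f 3‖ = 5 ∧
      ‖inverseCoeff f 4‖ = 14 ∧
      ‖inverseCoeff f 5‖ = 42) := by
  refine ⟨fun f hf ↦ ?_, koebe, koebe_mem_classF4, fun z hz ↦ ?_, ?_, norm_inverseCoeff_koebe⟩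
  · obtain ⟨h2, h3, h4, h5⟩ := norm_inverseCoeff_le hf
    have han := analyticAt_diskInverse hf.1.1 (ClassF4.injOn hf) (ClassF4.deriv_ne_zero hf)
      zero_mem_unitDisk
    rw [hf.1.2.1] at han
    exact ⟨⟨ClassF4.injOn hf, han⟩, h2, h3, fun _ ↦ ⟨h4, h5⟩⟩
  · have h1 := one_sub_ne_zero_of_mem_unitDisk hz
    rw [deriv_koebe hz]
    field_simp
  · simp [taylorCoeff_koebe_two]
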